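/- A graph on a set $X$ is a symmetric irreflexive binary relation on $X$. If $X$ is a topological space and $G$ is a graph on $X$, the continuous chromatic number $\chi_c(X,G)$ is the least cardinal $\kappa\le\aleph_0$ for which there is a continuous map $c:X\to\kappa$ ($\kappa$ discrete) with $c(x)\ne c(y)$ whenever $(x,y)\in G$, if such a $\kappa$ exists, and $\chi_c(X,G)=2^{\aleph_0}$ otherwise. If $f:\mathrm{dom} f\to X$ is a function with $\mathrm{dom} f\subseteq X$ (a partial function on $X$), the graph induced by $f$ is $G_f=\{(x,y)\in X^2 : x\neq y,\ (x\in\mathrm{dom} f\text{ and }f(x)=y)\text{ or }(y\in\mathrm{dom} f\text{ and }f(y)=x)\}$. A partial homeomorphism of $X$ is a homeomorphism from a subspace of $X$ onto a subspace of $X$; it is fixed-point-free if $f(x)\ne x$ for every $x\in\mathrm{dom} f$. A space is zero-dimensional if its clopen subsets form a base of its topology. Spaces may be empty, and countable includes finite. Theorem. Let $X$ be a zero-dimensional metrizable compact space and let $f$ be a partial continuous injection on $X$. (a) If $\mathrm{dom} f$ is open in $X$, then $\chi_c(X,G_f)\in\omega\cup\{2^{\aleph_0}\}$. Conversely, for every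 $\kappa\in\omega\cup\{2^{\aleph_0}\}$ there are a countable zero-dimensional metrizable compact space $X$ and a fixed-point-free partial homeomorphism $f$ of $X$ with open domain such that $\chi_c(X,G_f)=\kappa$. (b) If $\mathrm{dom} f$ is closed in $X$, then $\chi_c(X,G_f)\in\{0,1,2,3,2^{\aleph_0}\}$. Conversely, for every $\kappa\in\{0,1,2,3,2^{\aleph_0}\}$ there are a countable zero-dimensional metrizable compact space $X$ and a (total) homeomorphism $f:X\to X$ such that $\chi_c(X,G_f)=\kappa$. Moreover, there are a countable Polish space $X$ and a fixed-point-free partial homeomorphism $f$ of $X$ with open domain such that $\chi_c(X,G_f)=\aleph_0$. -/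

import Mathlib

open Topology Cardinal

universe u

/-- A topological space is zero-dimensional if its clopen subsets form a base of the topology. -/
def IsZeroDimensional (X : Type u) [TopologicalSpace X] : Prop :=
  TopologicalSpace.IsTopologicalBasis {s : Set X | IsClopen s}

/-- A zero-dimensional metrizable compact space (possibly empty). -/
structure IsZeroDimMetrizableCompact (X : Type u) [TopologicalSpace X] : Prop where
  compact : CompactSpace X
  metrizable : TopologicalSpace.MetrizableSpace X
  zeroDim : IsZeroDimensional X

/-- A continuous coloring of the graph `G` on the topological space `X`, with colors in the
discrete space `α` (continuity of `c` for the discrete topology `⊥` on `α`). -/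
def IsContinuousColoring {X : Type u} [TopologicalSpace X] (G : SimpleGraph X)
    {α : Type} (c : X → α) : Prop :=
  @Continuous X α _ ⊥ c ∧ ∀ x y : X, G.Adj x y → c x ≠ c y

/-- The set of the cardinals `κ ≤ ℵ₀` for which there is a continuous coloring of `G` taking
values in (a discrete space of cardinality) `κ`. -/
def continuousColoringNumbers {X : Type u} [TopologicalSpace X] (G : SimpleGraph X) :
    Set Cardinal.{0} :=
  {κ | κ ≤ ℵ₀ ∧ ∃ α : Type, #α = κ ∧ ∃ c : X → α, IsContinuousColoring G c}

open Classical in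
/-- The continuous chromatic number of `G`: the minimum cardinal `κ ≤ ℵ₀` for which there is a
continuous coloring of `G` in `κ` colors if there is one, and `2 ^ ℵ₀` otherwise. -/
noncomputable def continuousChromaticNumber {X : Type u} [TopologicalSpace X]
    (G : SimpleGraph X) : Cardinal.{0} :=
  if (continuousColoringNumbers G).Nonempty then sInf (continuousColoringNumbers G) else 2 ^ ℵ₀

/-- The graph induced by a partial function `f` on `X` with domain `D`: the symmetrization of the
graph `{(x, f x) | x ∈ D}` of `f`, minus the diagonal of `X`. -/
def inducedGraph {X : Type u} {D : Set X} (f : D → X) : SimpleGraph X where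
  Adj x y := ((∃ d : D, (d : X) = x ∧ f d = y) ∨ (∃ d : D, (d : X) = y ∧ f d = x)) ∧ x ≠ y
  symm := ⟨fun _ _ h => ⟨h.1.symm, h.2.symm⟩⟩
  loopless := ⟨fun _ h => h.2 rfl⟩

/-! A locally constant map on a compact space has finite range, so compactness alone excludes `ℵ₀`.
For a closed domain, any continuous coloring forces the edge relation to be closed
(`isClosed_inducedGraph`), so every point has a clopen neighborhood without edges. Finitely many of
these cover the space and are colored greedily: injectivity of `f` bounds degrees by two, so three
colors suffice (`exists_isContinuousColoring_fin_three`). For the converses, sequences indexed by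
`I`, any two matched infinitely often, force their limits to get distinct colors; finite `I` gives
the finite values and `I = ℕ` the Polish example. Two matched sequences with a common limit exclude
every continuous coloring. Cyclic permutations of at most three points settle the finite values for
total homeomorphisms. -/

open Set Filter

/-! ### Continuous colorings and compactness -/

section Coloring

variable {X : Type u} [TopologicalSpace X] {G : SimpleGraph X}

theorem isContinuousColoring_iff {α : Type} {c : X → α} :
    IsContinuousColoring G c ↔ IsLocallyConstant c ∧ ∀ x y, G.Adj x y → c x ≠ c y := by
  let _ : TopologicalSpace α := ⊥
  have : DiscreteTopology α := ⟨rfl⟩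
  rw [IsContinuousColoring, IsLocallyConstant.iff_continuous]

theorem continuousChromaticNumber_le {α : Type} {c : X → α} (hα : #α ≤ ℵ₀)
    (hc : IsContinuousColoring G c) : continuousChromaticNumber G ≤ #α := by
  have h : #α ∈ continuousColoringNumbers G := ⟨hα, α, rfl, c, hc⟩
  rw [continuousChromaticNumber, if_pos ⟨_, h⟩]
  exact csInf_le' h

theorem continuousChromaticNumber_eq_continuum
    (h : ∀ (α : Type) (c : X → α), ¬ IsContinuousColoring G c) :
    continuousChromaticNumber G = 2 ^ ℵ₀ := by
  rw [continuousChromaticNumber, if_neg]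
  rintro ⟨_, _, α, _, c, hc⟩
  exact h α c hc

theorem exists_coloring_or_eq_continuum :
    (∃ (α : Type) (c : X → α), IsContinuousColoring G c) ∨
      continuousChromaticNumber G = 2 ^ ℵ₀ := by
  by_cases h : ∃ (α : Type) (c : X → α), IsContinuousColoring G c
  · exact Or.inl h
  · push Not at h
    exact Or.inr (continuousChromaticNumber_eq_continuum h)

theorem continuousChromaticNumber_eq {α : Type} {c : X → α} (hα : #α ≤ ℵ₀)
    (hc : IsContinuousColoring G c)
    (hmin : ∀ (β : Type) (d : X → β), IsContinuousColoring G d → #α ≤ #β) :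
    continuousChromaticNumber G = #α := by
  refine (continuousChromaticNumber_le hα hc).antisymm ?_
  have h : #α ∈ continuousColoringNumbers G := ⟨hα, α, rfl, c, hc⟩
  rw [continuousChromaticNumber, if_pos ⟨_, h⟩]
  refine le_csInf ⟨_, h⟩ ?_
  rintro _ ⟨_, β, rfl, d, hd⟩
  exact hmin β d hd

/-- On a compact space a continuous coloring uses finitely many colors. -/
theorem continuousChromaticNumber_lt_aleph0 [CompactSpace X] {α : Type} {c : X → α}
    (hc : IsContinuousColoring G c) : continuousChromaticNumber G < ℵ₀ := by
  rw [isContinuousColoring_iff] at hc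
  have hfin : #(range c) < ℵ₀ := Cardinal.lt_aleph0_iff_finite.2 hc.1.range_finite
  refine (continuousChromaticNumber_le (c := rangeFactorization c) hfin.le ?_).trans_lt hfin
  refine isContinuousColoring_iff.2 ⟨?_, fun x y h he => hc.2 x y h (congrArg Subtype.val he)⟩
  refine (IsLocallyConstant.iff_eventually_eq _).2 fun x => ?_
  filter_upwards [hc.1.eventually_eq x] with y hy
  exact Subtype.ext hy

/-- There is no continuous coloring if the edges accumulate at a point of the diagonal. -/
theorem not_isContinuousColoring_of_tendsto {u v : ℕ → X} {x : X}
    (hu : Tendsto u atTop (𝓝 x)) (hv : Tendsto v atTop (𝓝 x)) (huv : ∀ n, G.Adj (u n) (v n))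
    (α : Type) (c : X → α) : ¬ IsContinuousColoring G c := by
  intro h
  rw [isContinuousColoring_iff] at h
  have hx := h.1.eventually_eq x
  obtain ⟨n, h₁, h₂⟩ := ((hu.eventually hx).and (hv.eventually hx)).exists
  exact h.2 _ _ (huv n) (h₁.trans h₂.symm)

end Coloring

/-! ### Gluing and greedy coloring on zero-dimensional compact spaces -/

section ZeroDimensional

variable {X : Type u} [TopologicalSpace X]

theorem IsLocallyConstant.ite_mem {α : Type*} {W : Set X} [DecidablePred (· ∈ W)]
    (hW : IsClopen W) {c g : X → α} (hc : IsLocallyConstant c) (hg : IsLocallyConstant g) :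
    IsLocallyConstant fun x => if x ∈ W then c x else g x := by
  refine (IsLocallyConstant.iff_eventually_eq _).2 fun x => ?_
  by_cases hx : x ∈ W
  · filter_upwards [hW.isOpen.mem_nhds hx, hc.eventually_eq x] with y hy hcy
    simp [hx, hy, hcy]
  · filter_upwards [hW.compl.isOpen.mem_nhds hx, hg.eventually_eq x] with y hy hgy
    simp only [mem_compl_iff] at hy
    simp [hx, hy, hgy]

/-- Locally constant solutions of a local selection problem on a compact zero-dimensional
space glue to a global one. -/
theorem IsZeroDimensional.exists_isLocallyConstant [CompactSpace X] (hX : IsZeroDimensional X)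
    {α : Type*} [Nonempty α] {P : X → α → Prop} (hP : ∀ x, ∃ a, ∀ᶠ y in 𝓝 x, P y a) :
    ∃ g : X → α, IsLocallyConstant g ∧ ∀ x, P x (g x) := by
  classical
  -- Compactness induction on the covered set; enlarging it to a clopen `C` lets two partial
  -- solutions be glued by cases.
  have key : ∃ C : Set X, IsClopen C ∧ Set.univ ⊆ C ∧
      ∃ g : X → α, IsLocallyConstant g ∧ ∀ x ∈ C, P x (g x) := by
    refine isCompact_univ.induction_on
      (p := fun S => ∃ C : Set X, IsClopen C ∧ S ⊆ C ∧
        ∃ g : X → α, IsLocallyConstant g ∧ ∀ x ∈ C, P x (g x)) ?_ ?_ ?_ ?_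
    · exact ⟨∅, isClopen_empty, subset_rfl, fun _ => Classical.arbitrary α,
        IsLocallyConstant.const _, by simp⟩
    · rintro s t hst ⟨C, hC, htC, h⟩
      exact ⟨C, hC, hst.trans htC, h⟩
    · rintro s t ⟨C, hC, hs, g, hg, hgP⟩ ⟨C', hC', ht, g', hg', hgP'⟩
      refine ⟨C ∪ C', hC.union hC', union_subset_union hs ht,
        fun x => if x ∈ C then g x else g' x, hg.ite_mem hC hg', fun x hx => ?_⟩
      by_cases hxC : x ∈ C
      · simpa [hxC] using hgP x hxC
      · simpa [hxC] using hgP' x (hx.resolve_left hxC)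
    · intro x _
      obtain ⟨a, ha⟩ := hP x
      obtain ⟨C, hC, hxC, hCP⟩ := hX.mem_nhds_iff.1 ha
      exact ⟨C, mem_nhdsWithin_of_mem_nhds ((IsClopen.isOpen hC).mem_nhds hxC), C, hC, subset_rfl,
        fun _ => a, IsLocallyConstant.const _, fun y hy => hCP hy⟩
  obtain ⟨C, -, hC, g, hg, hgP⟩ := key
  exact ⟨g, hg, fun x => hgP x (hC trivial)⟩

/-- A graph of degree at most two on a compact zero-dimensional space whose edge relation is
closed has a continuous coloring in three colors. -/
theorem exists_isContinuousColoring_fin_three [CompactSpace X] [T2Space X]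
    (hX : IsZeroDimensional X) {G : SimpleGraph X} (hG : IsClosed {p : X × X | G.Adj p.1 p.2})
    (hdeg : ∀ x, ∃ a b, ∀ y, G.Adj x y → y = a ∨ y = b) :
    ∃ c : X → Fin 3, IsContinuousColoring G c := by
  classical
  have hloc : ∀ x : X, ∃ U ∈ {s : Set X | IsClopen s}, x ∈ U ∧
      ∀ y ∈ U, ∀ z ∈ U, ¬ G.Adj y z := by
    intro x
    have h : ∀ᶠ p in 𝓝 x ×ˢ 𝓝 x, ¬ G.Adj p.1 p.2 := by
      rw [← nhds_prod_eq]
      exact hG.isOpen_compl.mem_nhds (by simp)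
    obtain ⟨V, hV, hVG⟩ := eventually_prod_self_iff'.1 h
    obtain ⟨U, hU, hxU, hUV⟩ := hX.mem_nhds_iff.1 hV
    exact ⟨U, hU, hxU, fun y hy z hz => hVG y (hUV hy) z (hUV hz)⟩
  choose U hU hxU hindep using hloc
  obtain ⟨t, ht⟩ := isCompact_univ.elim_finite_subcover U (fun x => (hU x).isOpen)
    fun x _ => mem_iUnion.2 ⟨x, hxU x⟩
  have key : ∀ s : Finset X, ∃ c : X → Fin 3, IsLocallyConstant c ∧
      ∀ y ∈ ⋃ x ∈ s, U x, ∀ z ∈ ⋃ x ∈ s, U x, G.Adj y z → c y ≠ c z := by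
    intro s
    induction s using Finset.induction_on with
    | empty => exact ⟨fun _ => 0, IsLocallyConstant.const _, by simp⟩
    | insert v s _ ih =>
      obtain ⟨c, hc, hcW⟩ := ih
      set W := ⋃ x ∈ s, U x with hWdef
      have hW : IsClopen W := s.finite_toSet.isClopen_biUnion fun x _ => hU x
      -- `g` selects locally constantly a color that no neighbor in `W` already has.
      obtain ⟨g, hg, hgP⟩ := hX.exists_isLocallyConstant
        (P := fun y (i : Fin 3) => ∀ z ∈ W, G.Adj y z → c z ≠ i) fun x => by
          obtain ⟨a, b, hab⟩ := hdeg x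
          obtain ⟨i, hia, hib⟩ : ∃ i : Fin 3, c a ≠ i ∧ c b ≠ i := by
            generalize c a = p
            generalize c b = q
            revert p q
            decide
          -- The points with a neighbor in `W` of color `i` form a projection of a compact set;
          -- hence `i` stays admissible near `x`.
          have hK : IsClosed (Prod.fst '' ({p : X × X | G.Adj p.1 p.2} ∩
              Prod.snd ⁻¹' (W ∩ c ⁻¹' {i}))) :=
            ((hG.inter ((hW.isClosed.inter (hc.isClosed_fiber i)).preimage
              continuous_snd)).isCompact.image continuous_fst).isClosed
          have hx : x ∉ Prod.fst '' ({p : X × X | G.Adj p.1 p.2} ∩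
              Prod.snd ⁻¹' (W ∩ c ⁻¹' {i})) := by
            rintro ⟨⟨x', z⟩, ⟨hxz, -, hzi⟩, rfl⟩
            rcases hab z hxz with rfl | rfl
            · exact hia hzi
            · exact hib hzi
          refine ⟨i, ?_⟩
          filter_upwards [hK.isOpen_compl.mem_nhds hx] with y hy z hz hyz hzi
          exact hy ⟨(y, z), ⟨hyz, hz, hzi⟩, rfl⟩
      -- Old colors are kept on `W`; two new points both lie in `U v`, which contains no edge.
      refine ⟨fun x => if x ∈ W then c x else g x, hc.ite_mem hW hg, fun y hy z hz hyz => ?_⟩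
      rw [Finset.set_biUnion_insert] at hy hz
      by_cases hyW : y ∈ W <;> by_cases hzW : z ∈ W
      · simpa [hyW, hzW] using hcW y hyW z hzW hyz
      · simpa [hyW, hzW] using hgP z y hyW hyz.symm
      · simpa [hyW, hzW] using (hgP y z hzW hyz).symm
      · exact (hindep v y (hy.resolve_right hyW) z (hz.resolve_right hzW) hyz).elim
  obtain ⟨c, hc, hcG⟩ := key t
  exact ⟨c, isContinuousColoring_iff.2
    ⟨hc, fun x y => hcG x (ht trivial) y (ht trivial)⟩⟩

end ZeroDimensional

/-! ### Graphs induced by partial injections -/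

section InducedGraph

variable {X : Type u}

theorem inducedGraph_neighbors {D : Set X} {f : D → X} (hf : Function.Injective f) (x : X) :
    ∃ a b, ∀ y, (inducedGraph f).Adj x y → y = a ∨ y = b := by
  classical
  refine ⟨if h : x ∈ D then f ⟨x, h⟩ else x, if h : ∃ d, f d = x then h.choose else x, ?_⟩
  rintro y ⟨⟨d, rfl, rfl⟩ | ⟨d, rfl, rfl⟩, -⟩
  · simp
  · have h : ∃ e, f e = f d := ⟨d, rfl⟩
    right
    rw [dif_pos h, hf h.choose_spec]

variable [TopologicalSpace X]

/-- If the graph induced by a continuous map with closed domain has a continuous coloring, then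
its edges stay away from the diagonal. -/
theorem isClosed_inducedGraph [CompactSpace X] [T2Space X] {D : Set X} {f : D → X}
    (hD : IsClosed D) (hf : Continuous f) {α : Type} {c : X → α}
    (hc : IsContinuousColoring (inducedGraph f) c) :
    IsClosed {p : X × X | (inducedGraph f).Adj p.1 p.2} := by
  rw [isContinuousColoring_iff] at hc
  have : CompactSpace D := isCompact_iff_compactSpace.1 hD.isCompact
  -- Near a fixed point `d`, both `e` and `f e` have the color of `d`, so `f e ≠ e` would give a
  -- monochromatic edge.
  have hE : IsClosed {d : D | f d ≠ d} := by
    refine isOpen_compl_iff.1 (isOpen_iff_mem_nhds.2 fun d hd => ?_)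
    simp only [ne_eq, mem_compl_iff, mem_ofPred_eq, not_not] at hd
    have h₁ := hf.continuousAt.eventually (hc.1.eventually_eq (f d))
    have h₂ := continuous_subtype_val.continuousAt.eventually (hc.1.eventually_eq (d : X))
    filter_upwards [h₁, h₂] with e he₁ he₂
    simp only [ne_eq, mem_compl_iff, mem_ofPred_eq, not_not]
    by_contra hne
    refine hc.2 (e : X) (f e) ⟨Or.inl ⟨e, rfl, rfl⟩, Ne.symm hne⟩ ?_
    rw [he₁, he₂, hd]
  -- The edge relation is this compact set together with its transpose.
  have hA : IsClosed ((fun d : D => ((d : X), f d)) '' {d : D | f d ≠ d}) :=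
    (hE.isCompact.image (by fun_prop)).isClosed
  convert hA.union (hA.preimage continuous_swap) using 1
  ext ⟨x, y⟩
  constructor
  · rintro ⟨⟨d, rfl, rfl⟩ | ⟨d, rfl, rfl⟩, hne⟩
    · exact Or.inl ⟨d, Ne.symm hne, rfl⟩
    · exact Or.inr ⟨d, hne, rfl⟩
  · rintro (⟨d, hd, h⟩ | ⟨d, hd, h⟩)
    · obtain ⟨rfl, rfl⟩ := Prod.ext_iff.1 h
      exact ⟨Or.inl ⟨d, rfl, rfl⟩, Ne.symm hd⟩
    · obtain ⟨h₁, h₂⟩ := Prod.ext_iff.1 h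
      simp only [Prod.fst_swap, Prod.snd_swap] at h₁ h₂
      subst h₁ h₂
      exact ⟨Or.inr ⟨d, rfl, rfl⟩, hd⟩

theorem continuousChromaticNumber_mem_of_isClosed (hX : IsZeroDimMetrizableCompact X)
    {D : Set X} {f : D → X} (hD : IsClosed D) (hf : Continuous f) (hinj : Function.Injective f) :
    continuousChromaticNumber (inducedGraph f) ∈ ({0, 1, 2, 3, 2 ^ ℵ₀} : Set Cardinal.{0}) := by
  have := hX.compact
  have := hX.metrizable
  rcases exists_coloring_or_eq_continuum (G := inducedGraph f) with ⟨α, c, hc⟩ | h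
  · obtain ⟨c', hc'⟩ := exists_isContinuousColoring_fin_three hX.zeroDim
      (isClosed_inducedGraph hD hf hc) (inducedGraph_neighbors hinj)
    have hle := continuousChromaticNumber_le (by simp) hc'
    obtain ⟨n, hn⟩ := Cardinal.lt_aleph0.1 (continuousChromaticNumber_lt_aleph0 hc')
    rw [hn] at hle ⊢
    have hn3 : n ≤ 3 := by
      rw [Cardinal.mk_fin] at hle
      exact_mod_cast hle
    interval_cases n <;> simp
  · simp [h]

/-- A fixed-point-free involution of a discrete open subspace, as a partial homeomorphism. -/
theorem exists_partialHomeomorph_of_involutive {P : Type*} [TopologicalSpace P]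
    [DiscreteTopology P] {g : P → X} (hg : IsOpenEmbedding g) {e : P → P}
    (he : Function.Involutive e) (hne : ∀ p, e p ≠ p) :
    ∃ (D R : Set X) (f : D ≃ₜ R), IsOpen D ∧ (∀ d : D, (f d : X) ≠ d) ∧
      ∀ x y, (inducedGraph fun d : D => (f d : X)).Adj x y ↔ ∃ p, x = g p ∧ y = g (e p) := by
  let h := hg.isEmbedding.toHomeomorph
  let f : range g ≃ₜ range g :=
    (h.symm.trans (he.toPerm.toHomeomorphOfDiscrete)).trans h
  have hf : ∀ p, (f (h p) : X) = g (e p) := fun p => by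
    change ((h (e (h.symm (h p)))) : X) = _
    rw [h.symm_apply_apply]
    rfl
  have hh : ∀ p, (h p : X) = g p := fun _ => rfl
  refine ⟨range g, range g, f, hg.isOpen_range, fun d => ?_, fun x y => ⟨?_, ?_⟩⟩
  · obtain ⟨p, rfl⟩ := h.surjective d
    rw [hf, hh]
    exact fun heq => hne p (hg.injective heq)
  · rintro ⟨⟨d, rfl, rfl⟩ | ⟨d, rfl, rfl⟩, -⟩
    · obtain ⟨p, rfl⟩ := h.surjective d
      exact ⟨p, rfl, hf p⟩
    · obtain ⟨p, rfl⟩ := h.surjective d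
      exact ⟨e p, hf p, by rw [he p, hh]⟩
  · rintro ⟨p, rfl, rfl⟩
    exact ⟨Or.inl ⟨h p, rfl, hf p⟩, fun heq => hne p (hg.injective heq.symm)⟩

end InducedGraph

/-! ### Compactifications of countable discrete spaces -/

section OnePoint

variable (P : Type*) [TopologicalSpace P] [DiscreteTopology P]

instance Filter.isCountablyGenerated_cofinite (Q : Type*) [Countable Q] :
    (cofinite : Filter Q).IsCountablyGenerated :=
  HasCountableBasis.isCountablyGenerated ⟨hasBasis_cofinite, Set.Countable.ofPred_finite⟩

instance OnePoint.countable_of_countable (Q : Type*) [Countable Q] : Countable (OnePoint Q) :=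
  inferInstanceAs (Countable (Option Q))

instance OnePoint.firstCountable_of_discrete [Countable P] :
    FirstCountableTopology (OnePoint P) where
  nhds_generated_countable x := by
    induction x using OnePoint.rec with
    | infty =>
      rw [OnePoint.nhds_infty_eq, coclosedCompact_eq_cocompact, cocompact_eq_cofinite]
      infer_instance
    | coe x =>
      rw [OnePoint.nhds_coe_eq]
      infer_instance

instance OnePoint.polishSpace_of_discrete [Countable P] : PolishSpace (OnePoint P) := by
  let _ := TopologicalSpace.metrizableSpaceMetric (OnePoint P)
  infer_instance

variable {P} in
theorem OnePoint.tendsto_coe_infty_of_injective {u : ℕ → P} (hu : Function.Injective u) :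
    Tendsto (fun n => (u n : OnePoint P)) atTop (𝓝 (OnePoint.infty : OnePoint P)) := by
  have h := (OnePoint.tendsto_coe_infty (X := P))
  rw [coclosedCompact_eq_cocompact, cocompact_eq_cofinite] at h
  rw [← Nat.cofinite_eq_atTop]
  exact h.comp hu.tendsto_cofinite

end OnePoint

theorem isZeroDimMetrizableCompact_of_totallyDisconnected (X : Type u) [TopologicalSpace X]
    [CompactSpace X] [T2Space X] [SecondCountableTopology X] [TotallyDisconnectedSpace X] :
    IsZeroDimMetrizableCompact X :=
  ⟨inferInstance, inferInstance, isTopologicalBasis_isClopen⟩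

/-! ### Matched convergent sequences with distinct limits -/

section Spikes

variable (I : Type) [TopologicalSpace I] [DiscreteTopology I]

/-- The isolated points `(i, j, n)` with `i ≠ j`; the point `(i, j, n)` lies on the `i`-th of the
convergent sequences in `I × OnePoint (I × ℕ)`. -/
abbrev SpikePoint : Type := {q : I × I × ℕ // q.1 ≠ q.2.1}

/-- The inclusion of the isolated points in `I × OnePoint (I × ℕ)`. -/
def spikeEmbedding (q : SpikePoint I) : I × OnePoint (I × ℕ) := (q.1.1, (q.1.2 : OnePoint (I × ℕ)))

/-- The involution matching the `i`-th sequence with the `j`-th one infinitely often. -/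
def spikeSwap (q : SpikePoint I) : SpikePoint I := ⟨(q.1.2.1, q.1.1, q.1.2.2), q.2.symm⟩

theorem isOpenEmbedding_spikeEmbedding : IsOpenEmbedding (spikeEmbedding I) :=
  (IsOpenEmbedding.id.prodMap OnePoint.isOpenEmbedding_coe).comp
    (isOpen_discrete _).isOpenEmbedding_subtypeVal

/-- The limits of the sequences get different colors, and the first coordinate is a coloring. -/
theorem exists_partialHomeomorph_continuousChromaticNumber_eq [Countable I] :
    ∃ (D R : Set (I × OnePoint (I × ℕ))) (f : D ≃ₜ R), IsOpen D ∧
      (∀ d : D, (f d : I × OnePoint (I × ℕ)) ≠ d) ∧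
      continuousChromaticNumber
        (inducedGraph fun d : D => (f d : I × OnePoint (I × ℕ))) = #I := by
  obtain ⟨D, R, f, hD, hf, hadj⟩ := exists_partialHomeomorph_of_involutive
    (isOpenEmbedding_spikeEmbedding I) (e := spikeSwap I) (fun _ => rfl)
    fun q h => q.2 (congrArg (fun q => q.1.1) h).symm
  refine ⟨D, R, f, hD, hf, continuousChromaticNumber_eq (c := Prod.fst) Cardinal.mk_le_aleph0
    (isContinuousColoring_iff.2 ⟨IsLocallyConstant.iff_continuous _ |>.2 continuous_fst, ?_⟩)
    fun β d hd => ?_⟩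
  · intro x y hxy
    obtain ⟨q, rfl, rfl⟩ := (hadj x y).1 hxy
    exact q.2
  · rw [isContinuousColoring_iff] at hd
    refine Cardinal.mk_le_of_injective (f := fun i => d (i, OnePoint.infty)) fun i j hij => ?_
    by_contra hne
    -- For fixed `j`, the points `(i, j, n)` converge to the `i`-th limit, while their partners `(j,
    -- i, n)` converge to the `j`-th.
    have hlim : ∀ i j : I, ∀ᶠ n : ℕ in atTop,
        d (i, ((j, n) : I × ℕ)) = d (i, OnePoint.infty) := fun i j =>
      (Tendsto.prodMk_nhds tendsto_const_nhds (OnePoint.tendsto_coe_infty_of_injective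
        (Prod.mk_right_injective j))).eventually (hd.1.eventually_eq (i, OnePoint.infty))
    obtain ⟨n, h₁, h₂⟩ := ((hlim i j).and (hlim j i)).exists
    exact hd.2 _ _ ((hadj _ _).2 ⟨⟨(i, j, n), hne⟩, rfl, rfl⟩) ((h₁.trans hij).trans h₂.symm)

end Spikes

/-! ### Matched sequences with a common limit -/

section SwapPairs

/-- The involution of `ℕ × Bool` exchanging `(n, true)` and `(n, false)`. -/
def swapPairs (p : ℕ × Bool) : ℕ × Bool := (p.1, !p.2)

theorem swapPairs_involutive : Function.Involutive swapPairs := fun p => by simp [swapPairs]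

theorem swapPairs_ne (p : ℕ × Bool) : swapPairs p ≠ p := fun h => by
  simpa [swapPairs] using congrArg Prod.snd h

/-- Both ends of the edges converge to the point at infinity. Only these edges matter, so the
partial and the total example share the argument. -/
theorem continuousChromaticNumber_eq_continuum_of_swapPairs {G : SimpleGraph (OnePoint (ℕ × Bool))}
    (h : ∀ p : ℕ × Bool, G.Adj p (swapPairs p)) : continuousChromaticNumber G = 2 ^ ℵ₀ :=
  continuousChromaticNumber_eq_continuum <| not_isContinuousColoring_of_tendsto
    (OnePoint.tendsto_coe_infty_of_injective (Prod.mk_left_injective true))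
    (OnePoint.tendsto_coe_infty_of_injective (Prod.mk_left_injective false))
    fun n => h (n, true)

theorem exists_partialHomeomorph_continuousChromaticNumber_eq_continuum :
    ∃ (D R : Set (OnePoint (ℕ × Bool))) (f : D ≃ₜ R), IsOpen D ∧
      (∀ d : D, (f d : OnePoint (ℕ × Bool)) ≠ d) ∧
      continuousChromaticNumber
        (inducedGraph fun d : D => (f d : OnePoint (ℕ × Bool))) = 2 ^ ℵ₀ := by
  obtain ⟨D, R, f, hD, hf, hadj⟩ := exists_partialHomeomorph_of_involutive
    (OnePoint.isOpenEmbedding_coe (X := ℕ × Bool)) swapPairs_involutive swapPairs_ne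
  exact ⟨D, R, f, hD, hf, continuousChromaticNumber_eq_continuum_of_swapPairs
    fun p => (hadj _ _).2 ⟨p, rfl, rfl⟩⟩

theorem exists_homeomorph_continuousChromaticNumber_eq_continuum :
    ∃ f : OnePoint (ℕ × Bool) ≃ₜ OnePoint (ℕ × Bool),
      continuousChromaticNumber
        (inducedGraph fun d : (Set.univ : Set (OnePoint (ℕ × Bool))) =>
          f (d : OnePoint (ℕ × Bool))) = 2 ^ ℵ₀ := by
  refine ⟨swapPairs_involutive.toPerm.toHomeomorphOfDiscrete.onePointCongr,
    continuousChromaticNumber_eq_continuum_of_swapPairs fun p =>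
      ⟨Or.inl ⟨⟨p, trivial⟩, rfl, rfl⟩, fun h => swapPairs_ne p ?_⟩⟩
  exact (OnePoint.coe_injective h).symm

end SwapPairs

/-- For `n ≤ 3` the cyclic permutation of `Fin n` induces the complete graph. -/
theorem continuousChromaticNumber_finRotate {n : ℕ} (hn : n ≤ 3) :
    continuousChromaticNumber
      (inducedGraph fun d : (Set.univ : Set (Fin n)) => finRotate n (d : Fin n)) = n := by
  have hrot : ∀ x y : Fin n, x ≠ y → finRotate n x = y ∨ finRotate n y = x := by
    interval_cases n <;> decide
  rw [← Cardinal.mk_fin n]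
  refine continuousChromaticNumber_eq (c := id) Cardinal.mk_le_aleph0
    (isContinuousColoring_iff.2 ⟨IsLocallyConstant.of_discrete _, fun _ _ h => h.2⟩)
    fun β d hd => Cardinal.mk_le_of_injective (f := d) fun x y hxy => ?_
  by_contra hne
  refine hd.2 x y ⟨?_, hne⟩ hxy
  rcases hrot x y hne with h | h
  · exact Or.inl ⟨⟨x, trivial⟩, rfl, h⟩
  · exact Or.inr ⟨⟨y, trivial⟩, rfl, h⟩


theorem theorem1p10 :
    -- (a) open domain: the possible values
    (∀ (X : Type u) [TopologicalSpace X], IsZeroDimMetrizableCompact X →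
      ∀ (D : Set X) (f : D → X), IsOpen D → Continuous f → Function.Injective f →
        continuousChromaticNumber (inducedGraph f) < ℵ₀ ∨
          continuousChromaticNumber (inducedGraph f) = 2 ^ ℵ₀) ∧
    -- (a) all of them are realized by fixed point free partial homeomorphisms with open domain
    -- on a countable zero-dimensional metrizable compact space
    (∀ κ : Cardinal.{0}, (κ < ℵ₀ ∨ κ = 2 ^ ℵ₀) →
      ∃ (X : Type) (_ : TopologicalSpace X), IsZeroDimMetrizableCompact X ∧ Countable X ∧
        ∃ (D R : Set X) (f : D ≃ₜ R), IsOpen D ∧ (∀ d : D, (f d : X) ≠ d) ∧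
          continuousChromaticNumber (inducedGraph fun d : D => (f d : X)) = κ) ∧
    -- (b) closed domain: the possible values
    (∀ (X : Type u) [TopologicalSpace X], IsZeroDimMetrizableCompact X →
      ∀ (D : Set X) (f : D → X), IsClosed D → Continuous f → Function.Injective f →
        continuousChromaticNumber (inducedGraph f) ∈ ({0, 1, 2, 3, 2 ^ ℵ₀} : Set Cardinal.{0})) ∧
    -- (b) all of them are realized by total homeomorphisms of a countable
    -- zero-dimensional metrizable compact space
    (∀ κ ∈ ({0, 1, 2, 3, 2 ^ ℵ₀} : Set Cardinal.{0}),
      ∃ (X : Type) (_ : TopologicalSpace X), IsZeroDimMetrizableCompact X ∧ Countable X ∧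
        ∃ f : X ≃ₜ X,
          continuousChromaticNumber
            (inducedGraph fun d : (Set.univ : Set X) => f (d : X)) = κ) ∧
    -- a countable Polish space with the value `ℵ₀`
    (∃ (X : Type) (_ : TopologicalSpace X), PolishSpace X ∧ Countable X ∧
      ∃ (D R : Set X) (f : D ≃ₜ R), IsOpen D ∧ (∀ d : D, (f d : X) ≠ d) ∧
        continuousChromaticNumber (inducedGraph fun d : D => (f d : X)) = ℵ₀) := by
  refine ⟨fun X _ hX D f _ _ _ => ?_, ?_, fun X _ hX D f hD hf hinj =>
    continuousChromaticNumber_mem_of_isClosed hX hD hf hinj, ?_, ?_⟩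
  · have := hX.compact
    exact exists_coloring_or_eq_continuum.imp_left fun ⟨_, _, hc⟩ =>
      continuousChromaticNumber_lt_aleph0 hc
  · rintro κ (hκ | rfl)
    · obtain ⟨n, rfl⟩ := Cardinal.lt_aleph0.1 hκ
      rw [← Cardinal.mk_fin n]
      exact ⟨Fin n × OnePoint (Fin n × ℕ), inferInstance,
        isZeroDimMetrizableCompact_of_totallyDisconnected _, inferInstance,
        exists_partialHomeomorph_continuousChromaticNumber_eq (Fin n)⟩
    · exact ⟨OnePoint (ℕ × Bool), inferInstance,
        isZeroDimMetrizableCompact_of_totallyDisconnected _, inferInstance,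
        exists_partialHomeomorph_continuousChromaticNumber_eq_continuum⟩
  · intro κ hκ
    have hfin : ∀ n : ℕ, n ≤ 3 → ∃ (X : Type) (_ : TopologicalSpace X),
        IsZeroDimMetrizableCompact X ∧ Countable X ∧ ∃ f : X ≃ₜ X, continuousChromaticNumber
          (inducedGraph fun d : (Set.univ : Set X) => f (d : X)) = n := fun n hn =>
      ⟨Fin n, inferInstance, isZeroDimMetrizableCompact_of_totallyDisconnected _, inferInstance,
        (finRotate n).toHomeomorphOfDiscrete, continuousChromaticNumber_finRotate hn⟩
    rcases hκ with rfl | rfl | rfl | rfl | rfl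
    · exact_mod_cast hfin 0 (by norm_num)
    · exact_mod_cast hfin 1 (by norm_num)
    · exact_mod_cast hfin 2 (by norm_num)
    · exact_mod_cast hfin 3 (by norm_num)
    · exact ⟨OnePoint (ℕ × Bool), inferInstance,
        isZeroDimMetrizableCompact_of_totallyDisconnected _, inferInstance,
        exists_homeomorph_continuousChromaticNumber_eq_continuum⟩
  · rw [← Cardinal.mk_nat]
    exact ⟨ℕ × OnePoint (ℕ × ℕ), inferInstance, inferInstance, inferInstance,
      exists_partialHomeomorph_continuousChromaticNumber_eq ℕ⟩
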